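/- Let $\Bbbk$ be a commutative ring of characteristic not equal to two and $z \in \Bbbk$. Let $A = A_0 \oplus A_1$ be an associative superalgebra over $\Bbbk$ that is symmetric, i.e. equipped with a linear map $\operatorname{tr} \colon A \to \Bbbk$ that vanishes on $A_1$, satisfies $\operatorname{tr}(ab) = (-1)^{\bar a \bar b}\operatorname{tr}(ba)$ for homogeneous $a,b \in A$ of parities $\bar a, \bar b$, and for which $a \mapsto (b \mapsto \operatorname{tr}(ab))$ is an isomorphism $A \to \operatorname{Hom}_\Bbbk(A,\Bbbk)$. Assume that $A$ is free as a $\Bbbk$-module with finite basis $B$, and let $\{b^\vee : b \in B\}$ be the dual basis, $\operatorname{tr}(a^\vee b) = \delta_{a,b}$ for $a, b \in B$. Let $n \ge 1$, let $A^{\otimes n}$ be the super tensor power, and for $a \in A$ put $a_i = 1^{\otimes (i-1)} \otimes a \otimes 1^{\otimes (n-i)}$; put $t_{i,j} = \sum_{b \in B} b_i b_j^\vee$. The quantum wreath algebra $H_n(A,z)$ is the free product of $A^{\otimes n}$ and the free algebra on $T_1, \dotsc, T_{n-1}$, modulo the relations \[ T_iT_j = T_jT_i \ (|i-j|>1), \qquad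 T_iT_{i+1}T_i = T_{i+1}T_iT_{i+1}, \qquad T_i^2 = z t_{i,i+1}T_i + 1, \qquad T_i \mathbf{a} = s_i(\mathbf{a})T_i \ (\mathbf{a} \in A^{\otimes n}), \] where $s_i$ acts on $A^{\otimes n}$ by superpermutation of the factors $i$ and $i+1$. The quantum affine wreath algebra $H_n^{\mathrm{aff}}(A,z)$ is the free product of $\Bbbk[X_1^{\pm1},\dotsc,X_n^{\pm1}]$ and $H_n(A,z)$, modulo the relations \[ T_iX_j = X_jT_i \ (j \ne i,i+1), \qquad T_iX_iT_i = X_{i+1}, \qquad X_i\mathbf{a} = \mathbf{a}X_i \ (\mathbf{a} \in A^{\otimes n}). \] Here the $T_i$ and $X_i^{\pm 1}$ are even, and $a_i$ has the parity of $a$. Let $H_{n,+}^{\mathrm{aff}}(A,z)$ be the subalgebra of $H_n^{\mathrm{aff}}(A,z)$ generated by (the image of) $H_n(A,z)$ and $X_1,\dotsc,X_n$. Let $Z(A)_0$ be the even part of the (super)center of $A$, and let $f = X_1^d + a_{(d-1)}X_1^{d-1} + \dotsb + a_{(0)} \in Z(A)_0[X_1]$ be a monic polynomial with $a_{(0)}$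 invertible; view $f$ as an element of $H_{n,+}^{\mathrm{aff}}(A,z) \subseteq H_n^{\mathrm{aff}}(A,z)$ by identifying $a \in A$ with $a_1 = a \otimes 1^{\otimes (n-1)}$. Let $\langle f \rangle$ and $\langle f \rangle_+$ be the two-sided ideals generated by $f$ in $H_n^{\mathrm{aff}}(A,z)$ and in $H_{n,+}^{\mathrm{aff}}(A,z)$ respectively, and put $H_n^f(A,z) = H_n^{\mathrm{aff}}(A,z)/\langle f\rangle$ and $H_{n,+}^f(A,z) = H_{n,+}^{\mathrm{aff}}(A,z)/\langle f\rangle_+$. Then the composite $\eta \colon H_{n,+}^{\mathrm{aff}}(A,z) \hookrightarrow H_n^{\mathrm{aff}}(A,z) \twoheadrightarrow H_n^f(A,z)$ induces an isomorphism of superalgebras \[ H_{n,+}^f(A,z) \cong H_n^f(A,z), \] and $\langle f\rangle \cap H_{n,+}^{\mathrm{aff}}(A,z) = \langle f\rangle_+$. -/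

import Mathlib

noncomputable section

namespace QuantumWreath

open scoped TensorProduct

universe u v w

/-! ## Super tensor powers

A superalgebra is a `ZMod 2`-graded algebra `A = 𝒜 0 ⊕ 𝒜 1`. -/

section SuperTensor

variable {k : Type u} {A : Type v} [CommRing k] [Ring A] [Algebra k A]

/-- The sign `(-1)^p`, for a parity `p`. -/
def sign (k : Type u) [CommRing k] (p : ZMod 2) : k := if p = 0 then 1 else -1

lemma sign_zero : sign k 0 = 1 := by simp [sign]

lemma sign_add (p q : ZMod 2) : sign k (p + q) = sign k p * sign k q := by
  have h : ∀ p : ZMod 2, p = 0 ∨ p = 1 := by decide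
  have h2 : (1 + 1 : ZMod 2) = 0 := by decide
  rcases h p with rfl | rfl <;> rcases h q with rfl | rfl <;> simp [sign, h2]

/-- The Koszul sign of the product of `a₁ ⊗ ⋯ ⊗ aₙ` and `b₁ ⊗ ⋯ ⊗ bₙ`, where `aᵢ` has parity `ε i`
and `bⱼ` has parity `δ j`: each `bⱼ` is moved to the left past all `aᵢ` with `j < i`. -/
def koszul (k : Type u) [CommRing k] {n : ℕ} (ε δ : Fin n → ZMod 2) : k :=
  ∏ i, ∏ j, if j < i then sign k (ε i * δ j) else 1

lemma koszul_zero_left {n : ℕ} (δ : Fin n → ZMod 2) : koszul k 0 δ = 1 := by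
  simp [koszul, sign_zero]

lemma koszul_zero_right {n : ℕ} (δ : Fin n → ZMod 2) : koszul k δ 0 = 1 := by
  simp [koszul, sign_zero]

lemma koszul_add_left {n : ℕ} (ε ε' δ : Fin n → ZMod 2) :
    koszul k (ε + ε') δ = koszul k ε δ * koszul k ε' δ := by
  simp only [koszul, ← Finset.prod_mul_distrib]
  refine Finset.prod_congr rfl fun i _ => Finset.prod_congr rfl fun j _ => ?_
  split_ifs <;> simp [add_mul, sign_add]

lemma koszul_add_right {n : ℕ} (ε δ δ' : Fin n → ZMod 2) :
    koszul k ε (δ + δ') = koszul k ε δ * koszul k ε δ' := by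
  simp only [koszul, ← Finset.prod_mul_distrib]
  refine Finset.prod_congr rfl fun i _ => Finset.prod_congr rfl fun j _ => ?_
  split_ifs <;> simp [mul_add, sign_add]

variable (𝒜 : ZMod 2 → Submodule k A) [GradedAlgebra 𝒜]

/-- The projection of the `k`-module `A^{⊗n}` onto `𝒜 (ε 1) ⊗ ⋯ ⊗ 𝒜 (ε n)`. -/
def projT {n : ℕ} (ε : Fin n → ZMod 2) :
    (⨂[k] (_ : Fin n), A) →ₗ[k] (⨂[k] (_ : Fin n), A) :=
  PiTensorProduct.map fun i => GradedAlgebra.proj 𝒜 (ε i)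

lemma proj_proj (p q : ZMod 2) (a : A) :
    GradedAlgebra.proj 𝒜 p (GradedAlgebra.proj 𝒜 q a) =
      if p = q then GradedAlgebra.proj 𝒜 q a else 0 := by
  simp only [GradedAlgebra.proj_apply]
  split_ifs with h
  · subst h
    rw [DirectSum.decompose_of_mem_same 𝒜 (SetLike.coe_mem _)]
  · rw [DirectSum.decompose_of_mem_ne 𝒜 (SetLike.coe_mem _) (Ne.symm h)]

lemma proj_mul (r p q : ZMod 2) (a b : A) :
    GradedAlgebra.proj 𝒜 r (GradedAlgebra.proj 𝒜 p a * GradedAlgebra.proj 𝒜 q b) =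
      if r = p + q then GradedAlgebra.proj 𝒜 p a * GradedAlgebra.proj 𝒜 q b else 0 := by
  simp only [GradedAlgebra.proj_apply]
  have hm : ((DirectSum.decompose 𝒜 a p : A) * (DirectSum.decompose 𝒜 b q : A)) ∈ 𝒜 (p + q) :=
    SetLike.mul_mem_graded (SetLike.coe_mem _) (SetLike.coe_mem _)
  split_ifs with h
  · subst h
    rw [DirectSum.decompose_of_mem_same 𝒜 hm]
  · rw [DirectSum.decompose_of_mem_ne 𝒜 hm (Ne.symm h)]

lemma proj_one (p : ZMod 2) : GradedAlgebra.proj 𝒜 p (1 : A) = if p = 0 then 1 else 0 := by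
  simp only [GradedAlgebra.proj_apply]
  have hm : (1 : A) ∈ 𝒜 0 := SetLike.GradedOne.one_mem
  split_ifs with h
  · subst h
    rw [DirectSum.decompose_of_mem_same 𝒜 hm]
  · rw [DirectSum.decompose_of_mem_ne 𝒜 hm (Ne.symm h)]

lemma proj_sum (a : A) : ∑ p : ZMod 2, GradedAlgebra.proj 𝒜 p a = a := by
  classical
  conv_rhs => rw [← DirectSum.sum_support_decompose 𝒜 a]
  symm
  refine Finset.sum_subset (Finset.subset_univ _) fun p _ hp => ?_
  simpa using hp

variable {𝒜}

lemma projT_sum {n : ℕ} (x : ⨂[k] (_ : Fin n), A) :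
    ∑ ε : Fin n → ZMod 2, projT 𝒜 ε x = x := by
  have h : ∑ ε : Fin n → ZMod 2, projT 𝒜 ε = LinearMap.id := by
    ext a
    simp only [LinearMap.compMultilinearMap_apply, LinearMap.sum_apply, projT,
      PiTensorProduct.map_tprod, LinearMap.id_apply]
    rw [← MultilinearMap.map_sum (PiTensorProduct.tprod k)
      (fun (i : Fin n) (p : ZMod 2) => GradedAlgebra.proj 𝒜 p (a i))]
    simp only [proj_sum]
  simpa using congrArg (fun φ => φ x) h

lemma projT_projT {n : ℕ} (ε δ : Fin n → ZMod 2) (x : ⨂[k] (_ : Fin n), A) :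
    projT 𝒜 ε (projT 𝒜 δ x) = if ε = δ then projT 𝒜 δ x else 0 := by
  induction x using PiTensorProduct.induction_on with
  | smul_tprod r a =>
    simp only [map_smul, projT, PiTensorProduct.map_tprod, proj_proj]
    split_ifs with h
    · subst h; simp
    · obtain ⟨i, hi⟩ := Function.ne_iff.1 h
      rw [MultilinearMap.map_coord_zero _ i (by simp [hi]), smul_zero]
  | add x y hx hy =>
    simp only [map_add, hx, hy]
    split_ifs <;> simp

lemma projT_mul {n : ℕ} (γ ε δ : Fin n → ZMod 2) (x y : ⨂[k] (_ : Fin n), A) :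
    projT 𝒜 γ (projT 𝒜 ε x * projT 𝒜 δ y) =
      if γ = ε + δ then projT 𝒜 ε x * projT 𝒜 δ y else 0 := by
  induction x using PiTensorProduct.induction_on with
  | smul_tprod r a =>
    induction y using PiTensorProduct.induction_on with
    | smul_tprod s b =>
      simp only [map_smul, projT, PiTensorProduct.map_tprod, smul_mul_assoc, mul_smul_comm,
        PiTensorProduct.tprod_mul_tprod, Pi.mul_apply, proj_mul]
      split_ifs with h
      · subst h
        simp [Pi.mul_def]
      · obtain ⟨i, hi⟩ := Function.ne_iff.1 h
        rw [MultilinearMap.map_coord_zero _ i (if_neg hi), smul_zero, smul_zero]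
    | add x y hx hy =>
      simp only [map_add, mul_add, hx, hy]
      split_ifs <;> simp
  | add x y hx hy =>
    simp only [map_add, add_mul, hx, hy]
    split_ifs <;> simp

lemma projT_one {n : ℕ} (ε : Fin n → ZMod 2) :
    projT 𝒜 ε (1 : ⨂[k] (_ : Fin n), A) = if ε = 0 then 1 else 0 := by
  simp only [PiTensorProduct.one_def, projT, PiTensorProduct.map_tprod, Pi.one_apply, proj_one]
  split_ifs with h
  · subst h; simp [Pi.one_def]
  · obtain ⟨i, hi⟩ := Function.ne_iff.1 h
    rw [MultilinearMap.map_coord_zero _ i (if_neg hi)]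

variable (𝒜)

/-- The multiplication of the superalgebra `A^{⊗n}`: on tensors `x = a₁ ⊗ ⋯ ⊗ aₙ` and
`y = b₁ ⊗ ⋯ ⊗ bₙ` of homogeneous elements, `x y = ± a₁b₁ ⊗ ⋯ ⊗ aₙbₙ` with the Koszul sign.
On the right-hand side, `LinearMap.mul` is the factorwise product without sign. -/
def superMul (n : ℕ) :
    (⨂[k] (_ : Fin n), A) →ₗ[k] (⨂[k] (_ : Fin n), A) →ₗ[k] (⨂[k] (_ : Fin n), A) :=
  ∑ ε : Fin n → ZMod 2, ∑ δ : Fin n → ZMod 2,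
    koszul k ε δ • (LinearMap.mul k (⨂[k] (_ : Fin n), A)).compl₁₂ (projT 𝒜 ε) (projT 𝒜 δ)

variable {𝒜}

lemma superMul_apply {n : ℕ} (x y : ⨂[k] (_ : Fin n), A) :
    superMul 𝒜 n x y = ∑ ε : Fin n → ZMod 2, ∑ δ : Fin n → ZMod 2,
      koszul k ε δ • (projT 𝒜 ε x * projT 𝒜 δ y) := by
  simp [superMul, LinearMap.sum_apply]

lemma superMul_assoc_left {n : ℕ} (x y z : ⨂[k] (_ : Fin n), A) :
    superMul 𝒜 n (superMul 𝒜 n x y) z =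
      ∑ ε : Fin n → ZMod 2, ∑ δ : Fin n → ZMod 2, ∑ γ : Fin n → ZMod 2,
        (koszul k ε δ * koszul k ε γ * koszul k δ γ) •
          (projT 𝒜 ε x * projT 𝒜 δ y * projT 𝒜 γ z) := by
  rw [superMul_apply x y]
  simp only [map_sum, map_smul, LinearMap.sum_apply, LinearMap.smul_apply]
  refine Finset.sum_congr rfl fun ε _ => Finset.sum_congr rfl fun δ _ => ?_
  rw [superMul_apply]
  simp only [projT_mul]
  rw [Finset.sum_eq_single (ε + δ) (by intro α _ hα; simp [hα]) (by simp), Finset.smul_sum]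
  refine Finset.sum_congr rfl fun γ _ => ?_
  simp [koszul_add_left, smul_smul, mul_assoc]

lemma superMul_assoc_right {n : ℕ} (x y z : ⨂[k] (_ : Fin n), A) :
    superMul 𝒜 n x (superMul 𝒜 n y z) =
      ∑ ε : Fin n → ZMod 2, ∑ δ : Fin n → ZMod 2, ∑ γ : Fin n → ZMod 2,
        (koszul k ε δ * koszul k ε γ * koszul k δ γ) •
          (projT 𝒜 ε x * projT 𝒜 δ y * projT 𝒜 γ z) := by
  rw [superMul_apply y z]
  simp only [map_sum, map_smul]
  have : ∀ δ γ : Fin n → ZMod 2,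
      koszul k δ γ • superMul 𝒜 n x (projT 𝒜 δ y * projT 𝒜 γ z) =
      ∑ ε : Fin n → ZMod 2, (koszul k ε δ * koszul k ε γ * koszul k δ γ) •
          (projT 𝒜 ε x * projT 𝒜 δ y * projT 𝒜 γ z) := by
    intro δ γ
    rw [superMul_apply, Finset.smul_sum]
    refine Finset.sum_congr rfl fun ε _ => ?_
    simp only [projT_mul]
    rw [Finset.sum_eq_single (δ + γ) (by intro α _ hα; simp [hα]) (by simp)]
    simp [koszul_add_right, smul_smul, mul_assoc, mul_comm]
  simp only [this]
  conv_rhs => rw [Finset.sum_comm]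
  refine Finset.sum_congr rfl fun δ _ => ?_
  rw [Finset.sum_comm]

lemma superMul_one_left {n : ℕ} (x : ⨂[k] (_ : Fin n), A) : superMul 𝒜 n 1 x = x := by
  rw [superMul_apply]
  simp only [projT_one]
  rw [Finset.sum_eq_single 0 (by intro α _ hα; simp [hα]) (by simp)]
  simpa [koszul_zero_left] using projT_sum (𝒜 := 𝒜) x

lemma superMul_one_right {n : ℕ} (x : ⨂[k] (_ : Fin n), A) : superMul 𝒜 n x 1 = x := by
  rw [superMul_apply, Finset.sum_comm]
  simp only [projT_one]
  rw [Finset.sum_eq_single 0 (by intro α _ hα; simp [hα]) (by simp)]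
  simpa [koszul_zero_right] using projT_sum (𝒜 := 𝒜) x

end SuperTensor

section SuperPower

variable {k : Type u} {A : Type v} [CommRing k] [Ring A] [Algebra k A]

/-- The `n`-fold tensor power `A^{⊗n}` of the superalgebra `A = 𝒜 0 ⊕ 𝒜 1`, as a superalgebra:
the `k`-module `A ⊗ ⋯ ⊗ A` with the multiplication `superMul`. -/
def SuperPower (𝒜 : ZMod 2 → Submodule k A) [GradedAlgebra 𝒜] (n : ℕ) : Type (max u v) :=
  ⨂[k] (_ : Fin n), A

namespace SuperPower

variable (𝒜 : ZMod 2 → Submodule k A) [GradedAlgebra 𝒜] (n : ℕ)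

instance : AddCommGroup (SuperPower 𝒜 n) := inferInstanceAs (AddCommGroup (⨂[k] (_ : Fin n), A))

instance : Module k (SuperPower 𝒜 n) := inferInstanceAs (Module k (⨂[k] (_ : Fin n), A))

instance : Ring (SuperPower 𝒜 n) :=
  { (inferInstance : AddCommGroup (SuperPower 𝒜 n)) with
    mul := fun x y => superMul 𝒜 n x y
    one := PiTensorProduct.tprod k (1 : Fin n → A)
    left_distrib := fun x y z => map_add (superMul 𝒜 n x) y z
    right_distrib := fun x y z => LinearMap.map_add₂ (superMul 𝒜 n) x y z
    zero_mul := fun x => LinearMap.map_zero₂ (superMul 𝒜 n) x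
    mul_zero := fun x => map_zero (superMul 𝒜 n x)
    mul_assoc := fun x y z =>
      (superMul_assoc_left (𝒜 := 𝒜) x y z).trans (superMul_assoc_right (𝒜 := 𝒜) x y z).symm
    one_mul := fun x => superMul_one_left (𝒜 := 𝒜) x
    mul_one := fun x => superMul_one_right (𝒜 := 𝒜) x }

instance : Algebra k (SuperPower 𝒜 n) :=
  Algebra.ofModule (fun r x y => LinearMap.map_smul₂ (superMul 𝒜 n) r x y)
    (fun r x y => map_smul (superMul 𝒜 n x) r y)

variable {n}

/-- The pure tensor `a₁ ⊗ ⋯ ⊗ aₙ`. -/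
def tprod (a : Fin n → A) : SuperPower 𝒜 n := PiTensorProduct.tprod k a

lemma projT_tprod {c : Fin n → A} {γ : Fin n → ZMod 2} (hc : ∀ i, c i ∈ 𝒜 (γ i))
    (α : Fin n → ZMod 2) :
    projT 𝒜 α (PiTensorProduct.tprod k c) = if α = γ then PiTensorProduct.tprod k c else 0 := by
  simp only [projT, PiTensorProduct.map_tprod, GradedAlgebra.proj_apply]
  split_ifs with h
  · subst h
    congr 1
    funext i
    exact DirectSum.decompose_of_mem_same 𝒜 (hc i)
  · obtain ⟨i, hi⟩ := Function.ne_iff.1 h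
    exact MultilinearMap.map_coord_zero _ i
      (DirectSum.decompose_of_mem_ne 𝒜 (hc i) (Ne.symm hi))

/-- The product of two tensors of homogeneous elements. -/
lemma tprod_mul_tprod {a b : Fin n → A} {ε δ : Fin n → ZMod 2}
    (ha : ∀ i, a i ∈ 𝒜 (ε i)) (hb : ∀ i, b i ∈ 𝒜 (δ i)) :
    tprod 𝒜 a * tprod 𝒜 b = koszul k ε δ • tprod 𝒜 (fun i => a i * b i) := by
  change superMul 𝒜 n (PiTensorProduct.tprod k a) (PiTensorProduct.tprod k b) = _
  rw [superMul_apply]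
  simp only [projT_tprod 𝒜 ha, projT_tprod 𝒜 hb]
  rw [Finset.sum_eq_single ε (by intro α _ hα; simp [hα]) (by simp),
    Finset.sum_eq_single δ (by intro α _ hα; simp [hα]) (by simp)]
  simp only [if_true, PiTensorProduct.tprod_mul_tprod]
  rfl

/-- The algebra homomorphism `a ↦ aᵢ = 1^{⊗(i-1)} ⊗ a ⊗ 1^{⊗(n-i)}`. -/
def single (i : Fin n) : A →ₐ[k] SuperPower 𝒜 n :=
  AlgHom.ofLinearMap
    ((PiTensorProduct.singleAlgHom (R := k) (A := fun _ : Fin n => A) i).toLinearMap :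
      A →ₗ[k] (⨂[k] (_ : Fin n), A))
    (by
      change (PiTensorProduct.singleAlgHom (R := k) (A := fun _ : Fin n => A) i) 1 = _
      rw [map_one]; rfl)
    (by
      have hs : ∀ (p : ZMod 2) (c : A), c ∈ 𝒜 p → ∀ j,
          (Pi.mulSingle i c : Fin n → A) j ∈ 𝒜 ((Pi.single i p : Fin n → ZMod 2) j) := by
        intro p c hc j
        by_cases h : j = i
        · subst h; simpa using hc
        · simpa [h] using (SetLike.GradedOne.one_mem : (1 : A) ∈ 𝒜 0)
      have hk : ∀ p q : ZMod 2, koszul k (Pi.single i p : Fin n → ZMod 2) (Pi.single i q) = 1 := by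
        intro p q
        refine Finset.prod_eq_one fun j _ => Finset.prod_eq_one fun l _ => ?_
        split_ifs with h
        · by_cases hj : j = i
          · subst hj; simp [h.ne, sign_zero]
          · simp [hj, sign_zero]
        · rfl
      have hom : ∀ (p q : ZMod 2) (a b : A), a ∈ 𝒜 p → b ∈ 𝒜 q →
          tprod 𝒜 (Pi.mulSingle i (a * b)) =
            tprod 𝒜 (Pi.mulSingle i a) * tprod 𝒜 (Pi.mulSingle i b) := by
        intro p q a b ha hb
        rw [tprod_mul_tprod 𝒜 (hs p a ha) (hs q b hb), hk, one_smul, Pi.mulSingle_mul]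
        rfl
      intro a b
      let L : A →ₗ[k] SuperPower 𝒜 n :=
        ((PiTensorProduct.singleAlgHom (R := k) (A := fun _ : Fin n => A) i).toLinearMap :
          A →ₗ[k] (⨂[k] (_ : Fin n), A))
      change L (a * b) = L a * L b
      induction a using DirectSum.Decomposition.inductionOn 𝒜 with
      | zero => simp
      | @homogeneous p a =>
        induction b using DirectSum.Decomposition.inductionOn 𝒜 with
        | zero => simp
        | @homogeneous q b => exact hom p q a b a.2 b.2
        | add b b' h h' => rw [mul_add, map_add, h, h', map_add, mul_add]
      | add a a' h h' => rw [add_mul, map_add, h, h', map_add, add_mul])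

lemma single_apply (i : Fin n) (a : A) : single 𝒜 i a = tprod 𝒜 (Pi.mulSingle i a) := rfl

/-- The superpermutation of `A^{⊗n}` by the transposition of two adjacent positions `i`, `j`:
on tensors of homogeneous elements, `⋯ ⊗ aᵢ ⊗ aⱼ ⊗ ⋯ ↦ (-1)^{āᵢ āⱼ} ⋯ ⊗ aⱼ ⊗ aᵢ ⊗ ⋯`. -/
def superSwap (i j : Fin n) : SuperPower 𝒜 n →ₗ[k] SuperPower 𝒜 n :=
  (∑ ε : Fin n → ZMod 2, sign k (ε i * ε j) •
    ((PiTensorProduct.reindex k (fun _ : Fin n => A) (Equiv.swap i j)).toLinearMap ∘ₗ projT 𝒜 ε) :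
    (⨂[k] (_ : Fin n), A) →ₗ[k] (⨂[k] (_ : Fin n), A))

lemma superSwap_tprod (i j : Fin n) {a : Fin n → A} {ε : Fin n → ZMod 2}
    (ha : ∀ i, a i ∈ 𝒜 (ε i)) :
    superSwap 𝒜 i j (tprod 𝒜 a) =
      sign k (ε i * ε j) • tprod 𝒜 (fun l => a (Equiv.swap i j l)) := by
  change (∑ ε : Fin n → ZMod 2, sign k (ε i * ε j) •
    ((PiTensorProduct.reindex k (fun _ : Fin n => A) (Equiv.swap i j)).toLinearMap ∘ₗ projT 𝒜 ε))
      (PiTensorProduct.tprod k a) = _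
  simp only [LinearMap.sum_apply, LinearMap.smul_apply, LinearMap.comp_apply,
    projT_tprod 𝒜 ha]
  rw [Finset.sum_eq_single ε (by intro α _ hα; simp [hα]) (by simp)]
  simp only [if_true, LinearEquiv.coe_coe, PiTensorProduct.reindex_tprod, Equiv.symm_swap]
  rfl

end SuperPower

end SuperPower

/-! ## Symmetric superalgebras -/

section Symmetric

variable {k : Type u} {A : Type v} [CommRing k] [Ring A] [Algebra k A]

/-- A parity-preserving, supersymmetric, nondegenerate trace map; `A` together with such a map is a
symmetric superalgebra. (Here `k` lives in parity zero.) -/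
structure SuperTrace (𝒜 : ZMod 2 → Submodule k A) where
  tr : A →ₗ[k] k
  even : ∀ a ∈ 𝒜 1, tr a = 0
  supersymm : ∀ p q : ZMod 2, ∀ a ∈ 𝒜 p, ∀ b ∈ 𝒜 q, tr (a * b) = sign k (p * q) * tr (b * a)
  bijective : Function.Bijective (LinearMap.compr₂ (LinearMap.mul k A) tr)

namespace SuperTrace

variable {𝒜 : ZMod 2 → Submodule k A} (τ : SuperTrace 𝒜)

/-- The isomorphism `A → Hom(A, k)`, `a ↦ (b ↦ tr (a b))`. -/
def toDual : A ≃ₗ[k] (A →ₗ[k] k) :=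
  LinearEquiv.ofBijective (LinearMap.compr₂ (LinearMap.mul k A) τ.tr) τ.bijective

/-- The dual basis element `b^∨` of the `s`-th element `b` of the basis `B`. -/
def dual {ι : Type w} (B : Module.Basis ι k A) (s : ι) : A := τ.toDual.symm (B.coord s)

/-- The defining property of the dual basis. -/
lemma tr_dual_mul {ι : Type w} [DecidableEq ι] (B : Module.Basis ι k A) (s t : ι) :
    τ.tr (τ.dual B s * B t) = if s = t then 1 else 0 := by
  have h : τ.toDual (τ.dual B s) (B t) = τ.tr (τ.dual B s * B t) := rfl
  rw [← h, dual, LinearEquiv.apply_symm_apply, Module.Basis.coord_apply, Module.Basis.repr_self,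
    Finsupp.single_apply]
  simp only [eq_comm]

/-- The teleporter `t_{i,j} = ∑_{b ∈ B} bᵢ b^∨ⱼ`. -/
def teleporter [GradedAlgebra 𝒜] {ι : Type w} [Fintype ι] (B : Module.Basis ι k A) {n : ℕ}
    (i j : Fin n) : SuperPower 𝒜 n :=
  ∑ s, SuperPower.single 𝒜 i (B s) * SuperPower.single 𝒜 j (τ.dual B s)

end SuperTrace

/-- `Z(A)_0`, the even part of the center of the superalgebra `A`. As `a` is even, the sign in
`a b = (-1)^{ā b̄} b a` is `1`. -/
def evenCenter (𝒜 : ZMod 2 → Submodule k A) : Submodule k A :=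
  𝒜 0 ⊓ Subalgebra.toSubmodule (Subalgebra.center k A)

end Symmetric

/-! ## Free products of algebras -/

section FreeProduct

variable (k : Type u) [CommRing k] (R : Type v) (S : Type w) [Ring R] [Ring S]
  [Algebra k R] [Algebra k S]

/-- The relations of the free product `R ⋆ S`: those that hold in `R` and those that hold in `S`. -/
inductive FreeProd.Rel : FreeAlgebra k (R ⊕ S) → FreeAlgebra k (R ⊕ S) → Prop
  | inl_algebraMap (c : k) :
      Rel (FreeAlgebra.ι k (Sum.inl (algebraMap k R c))) (algebraMap k _ c)
  | inl_add (x y : R) : Rel (FreeAlgebra.ι k (Sum.inl (x + y)))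
      (FreeAlgebra.ι k (Sum.inl x) + FreeAlgebra.ι k (Sum.inl y))
  | inl_mul (x y : R) : Rel (FreeAlgebra.ι k (Sum.inl (x * y)))
      (FreeAlgebra.ι k (Sum.inl x) * FreeAlgebra.ι k (Sum.inl y))
  | inr_algebraMap (c : k) :
      Rel (FreeAlgebra.ι k (Sum.inr (algebraMap k S c))) (algebraMap k _ c)
  | inr_add (x y : S) : Rel (FreeAlgebra.ι k (Sum.inr (x + y)))
      (FreeAlgebra.ι k (Sum.inr x) + FreeAlgebra.ι k (Sum.inr y))
  | inr_mul (x y : S) : Rel (FreeAlgebra.ι k (Sum.inr (x * y)))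
      (FreeAlgebra.ι k (Sum.inr x) * FreeAlgebra.ι k (Sum.inr y))

/-- The free product (coproduct) `R ⋆ S` of two `k`-algebras. -/
def FreeProd : Type (max u v w) := RingQuot (FreeProd.Rel k R S)

namespace FreeProd

instance : Ring (FreeProd k R S) := inferInstanceAs (Ring (RingQuot (FreeProd.Rel k R S)))

instance : Algebra k (FreeProd k R S) :=
  inferInstanceAs (Algebra k (RingQuot (FreeProd.Rel k R S)))

/-- The quotient map from the free algebra. -/
def mk : FreeAlgebra k (R ⊕ S) →ₐ[k] FreeProd k R S := RingQuot.mkAlgHom k (FreeProd.Rel k R S)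

lemma mk_rel {x y : FreeAlgebra k (R ⊕ S)} (h : FreeProd.Rel k R S x y) :
    mk k R S x = mk k R S y := RingQuot.mkAlgHom_rel k h

/-- The canonical map `R → R ⋆ S`. -/
def inl : R →ₐ[k] FreeProd k R S :=
  AlgHom.ofLinearMap
    { toFun := fun x => mk k R S (FreeAlgebra.ι k (Sum.inl x))
      map_add' := fun x y => by rw [mk_rel k R S (Rel.inl_add x y), map_add]
      map_smul' := fun c x => by
        rw [Algebra.smul_def, mk_rel k R S (Rel.inl_mul _ x), map_mul,
          mk_rel k R S (Rel.inl_algebraMap c), AlgHom.commutes, RingHom.id_apply,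
          Algebra.smul_def] }
    (by
      change mk k R S (FreeAlgebra.ι k (Sum.inl 1)) = 1
      rw [← map_one (algebraMap k R), mk_rel k R S (Rel.inl_algebraMap 1), map_one, map_one])
    (fun x y => by
      change mk k R S (FreeAlgebra.ι k (Sum.inl (x * y))) = _
      rw [mk_rel k R S (Rel.inl_mul x y), map_mul]; rfl)

/-- The canonical map `S → R ⋆ S`. -/
def inr : S →ₐ[k] FreeProd k R S :=
  AlgHom.ofLinearMap
    { toFun := fun x => mk k R S (FreeAlgebra.ι k (Sum.inr x))
      map_add' := fun x y => by rw [mk_rel k R S (Rel.inr_add x y), map_add]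
      map_smul' := fun c x => by
        rw [Algebra.smul_def, mk_rel k R S (Rel.inr_mul _ x), map_mul,
          mk_rel k R S (Rel.inr_algebraMap c), AlgHom.commutes, RingHom.id_apply,
          Algebra.smul_def] }
    (by
      change mk k R S (FreeAlgebra.ι k (Sum.inr 1)) = 1
      rw [← map_one (algebraMap k S), mk_rel k R S (Rel.inr_algebraMap 1), map_one, map_one])
    (fun x y => by
      change mk k R S (FreeAlgebra.ι k (Sum.inr (x * y))) = _
      rw [mk_rel k R S (Rel.inr_mul x y), map_mul]; rfl)

end FreeProd

end FreeProduct

/-! ## Quantum wreath algebras and quantum affine wreath algebras -/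

section Hecke

/-- The position `i`, for a simple transposition `s_i = (i, i+1)`. -/
def lo {n : ℕ} (i : Fin (n - 1)) : Fin n := ⟨i, by omega⟩

/-- The position `i + 1`, for a simple transposition `s_i = (i, i+1)`. -/
def hi {n : ℕ} (i : Fin (n - 1)) : Fin n := ⟨i + 1, by omega⟩

variable {k : Type u} {A : Type v} [CommRing k] [Ring A] [Algebra k A]
  {𝒜 : ZMod 2 → Submodule k A} [GradedAlgebra 𝒜]

/-- The free product `A^{⊗n} ⋆ ⟨T_i : 1 ≤ i ≤ n - 1⟩`. -/
abbrev PreWreath (𝒜 : ZMod 2 → Submodule k A) [GradedAlgebra 𝒜] (n : ℕ) : Type (max u v) :=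
  FreeProd k (SuperPower 𝒜 n) (FreeAlgebra k (Fin (n - 1)))

namespace PreWreath

/-- The generator `T_i` in the free product. -/
def T {n : ℕ} (i : Fin (n - 1)) : PreWreath 𝒜 n := FreeProd.inr k _ _ (FreeAlgebra.ι k i)

/-- The element `𝐚 ∈ A^{⊗n}` in the free product. -/
def of {n : ℕ} : SuperPower 𝒜 n →ₐ[k] PreWreath 𝒜 n := FreeProd.inl k _ _

end PreWreath

variable (τ : SuperTrace 𝒜) {ι : Type w} [Fintype ι] (B : Module.Basis ι k A)

open PreWreath in
/-- The defining relations of `H_n(A, z)`. -/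
inductive Wreath.Rel (z : k) (n : ℕ) : PreWreath 𝒜 n → PreWreath 𝒜 n → Prop
  | far (i j : Fin (n - 1)) (h : (i : ℕ) + 1 < j ∨ (j : ℕ) + 1 < i) : Rel z n (T i * T j) (T j * T i)
  | braid (i j : Fin (n - 1)) (h : (j : ℕ) = i + 1) :
      Rel z n (T i * T j * T i) (T j * T i * T j)
  | quadratic (i : Fin (n - 1)) :
      Rel z n (T i ^ 2) (z • (of (τ.teleporter B (lo i) (hi i)) * T i) + 1)
  | swap (i : Fin (n - 1)) (a : SuperPower 𝒜 n) :
      Rel z n (T i * of a) (of (SuperPower.superSwap 𝒜 (lo i) (hi i) a) * T i)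

/-- The quantum wreath algebra `H_n(A, z)`. (For `n = 1` there are no `T_i` and it is `A`, and for
`n = 0` it is `k`.) -/
def Wreath (z : k) (n : ℕ) : Type (max u v) := RingQuot (Wreath.Rel τ B z n)

namespace Wreath

variable (z : k) (n : ℕ)

instance : Ring (Wreath τ B z n) := inferInstanceAs (Ring (RingQuot (Wreath.Rel τ B z n)))

instance : Algebra k (Wreath τ B z n) :=
  inferInstanceAs (Algebra k (RingQuot (Wreath.Rel τ B z n)))

/-- The quotient map from the free product. -/
def mk : PreWreath 𝒜 n →ₐ[k] Wreath τ B z n := RingQuot.mkAlgHom k (Wreath.Rel τ B z n)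

/-- The natural map `A^{⊗n} → H_n(A, z)`. -/
def of : SuperPower 𝒜 n →ₐ[k] Wreath τ B z n := (mk τ B z n).comp PreWreath.of

/-- The generator `T_i` of `H_n(A, z)`. -/
def T {n : ℕ} (i : Fin (n - 1)) : Wreath τ B z n := mk τ B z n (PreWreath.T i)

end Wreath

/-- The Laurent polynomial algebra `P_n = k[X_1^{±1}, …, X_n^{±1}]`, as the group algebra of
`ℤ^n`. -/
abbrev Laurent (k : Type u) [CommRing k] (n : ℕ) : Type u := AddMonoidAlgebra k (Fin n →₀ ℤ)

/-- The Laurent monomial `X_i^m`. -/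
def Laurent.X (k : Type u) [CommRing k] {n : ℕ} (i : Fin n) (m : ℤ) : Laurent k n :=
  AddMonoidAlgebra.single (Finsupp.single i m) 1

/-- The free product `P_n ⋆ H_n(A, z)`. -/
abbrev PreAff (z : k) (n : ℕ) : Type (max u v) := FreeProd k (Laurent k n) (Wreath τ B z n)

namespace PreAff

/-- The generator `X_i` in the free product. -/
def X (z : k) {n : ℕ} (i : Fin n) : PreAff τ B z n := FreeProd.inl k _ _ (Laurent.X k i 1)

/-- The generator `T_i` in the free product. -/
def T (z : k) {n : ℕ} (i : Fin (n - 1)) : PreAff τ B z n := FreeProd.inr k _ _ (Wreath.T τ B z i)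

/-- The element `𝐚 ∈ A^{⊗n}` in the free product. -/
def of (z : k) {n : ℕ} (a : SuperPower 𝒜 n) : PreAff τ B z n :=
  FreeProd.inr k _ _ (Wreath.of τ B z n a)

end PreAff

open PreAff in
/-- The defining relations of `H_n^aff(A, z)`. -/
inductive Aff.Rel (z : k) (n : ℕ) : PreAff τ B z n → PreAff τ B z n → Prop
  | commute (i : Fin (n - 1)) (j : Fin n) (h : j ≠ lo i) (h' : j ≠ hi i) :
      Rel z n (T τ B z i * X τ B z j) (X τ B z j * T τ B z i)
  | inverse (i : Fin (n - 1)) :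
      Rel z n (T τ B z i * X τ B z (lo i) * T τ B z i) (X τ B z (hi i))
  | pna (i : Fin n) (a : SuperPower 𝒜 n) :
      Rel z n (X τ B z i * of τ B z a) (of τ B z a * X τ B z i)

/-- The quantum affine wreath algebra `H_n^aff(A, z)`. -/
def Aff (z : k) (n : ℕ) : Type (max u v) := RingQuot (Aff.Rel τ B z n)

namespace Aff

variable (z : k) (n : ℕ)

instance : Ring (Aff τ B z n) := inferInstanceAs (Ring (RingQuot (Aff.Rel τ B z n)))

instance : Algebra k (Aff τ B z n) := inferInstanceAs (Algebra k (RingQuot (Aff.Rel τ B z n)))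

/-- The quotient map from the free product. -/
def mk : PreAff τ B z n →ₐ[k] Aff τ B z n := RingQuot.mkAlgHom k (Aff.Rel τ B z n)

/-- The natural map `P_n → H_n^aff(A, z)`. -/
def ofLaurent : Laurent k n →ₐ[k] Aff τ B z n := (mk τ B z n).comp (FreeProd.inl k _ _)

/-- The natural map `H_n(A, z) → H_n^aff(A, z)`. -/
def ofWreath : Wreath τ B z n →ₐ[k] Aff τ B z n := (mk τ B z n).comp (FreeProd.inr k _ _)

variable {n}

/-- The power `X_i^m` in `H_n^aff(A, z)`, for an integer `m`. -/
def X (i : Fin n) (m : ℤ) : Aff τ B z n := ofLaurent τ B z n (Laurent.X k i m)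

/-- The generator `T_i` of `H_n^aff(A, z)`. -/
def T (i : Fin (n - 1)) : Aff τ B z n := ofWreath τ B z n (Wreath.T τ B z i)

/-- The element `aᵢ` of `H_n^aff(A, z)`, for `a ∈ A`. -/
def single (i : Fin n) : A →ₐ[k] Aff τ B z n :=
  ((ofWreath τ B z n).comp (Wreath.of τ B z n)).comp (SuperPower.single 𝒜 i)

variable (n)

/-- The homogeneous elements of the superalgebra `H_n^aff(A, z)`: the `X_i^{±1}` and the `T_i` are
even, and `aᵢ` has the parity of `a`. -/
inductive IsHomogeneous : ZMod 2 → Aff τ B z n → Prop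
  | scalar (c : k) : IsHomogeneous 0 (algebraMap k _ c)
  | X (i : Fin n) (m : ℤ) : IsHomogeneous 0 (X τ B z i m)
  | T (i : Fin (n - 1)) : IsHomogeneous 0 (T τ B z i)
  | single (i : Fin n) (p : ZMod 2) (a : A) (ha : a ∈ 𝒜 p) : IsHomogeneous p (single τ B z i a)
  | zero (p : ZMod 2) : IsHomogeneous p 0
  | add {p : ZMod 2} {x y : Aff τ B z n} :
      IsHomogeneous p x → IsHomogeneous p y → IsHomogeneous p (x + y)
  | mul {p q : ZMod 2} {x y : Aff τ B z n} :
      IsHomogeneous p x → IsHomogeneous q y → IsHomogeneous (p + q) (x * y)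

/-- The part of parity `p` of `H_n^aff(A, z)`. -/
def part (p : ZMod 2) : Submodule k (Aff τ B z n) where
  carrier := {x | IsHomogeneous τ B z n p x}
  add_mem' := IsHomogeneous.add
  zero_mem' := IsHomogeneous.zero p
  smul_mem' c x hx := by
    have h := IsHomogeneous.mul (IsHomogeneous.scalar (τ := τ) (B := B) (z := z) c) hx
    rwa [zero_add, ← Algebra.smul_def] at h

end Aff

/-- `H_{n,+}^aff(A, z)`: the subalgebra of `H_n^aff(A, z)` generated by `H_n(A, z)` and
`X_1, …, X_n`. -/
def affPlus (z : k) (n : ℕ) : Subalgebra k (Aff τ B z n) :=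
  Algebra.adjoin k (Set.range (Aff.ofWreath τ B z n) ∪ Set.range fun i => Aff.X τ B z i 1)

/-! ## Cyclotomic quotients -/

variable (z : k) (n : ℕ) [NeZero n] (f : Polynomial A)

/-- The image in `H_n^aff(A, z)` of `f ∈ A[X_1]`, where `A` is identified with
`A ⊗ 1^{⊗(n-1)}`. (The first position is `0 : Fin n`.) -/
def polyElem : Aff τ B z n :=
  f.sum fun m a => Aff.single τ B z (0 : Fin n) a * Aff.X τ B z (0 : Fin n) 1 ^ m

lemma polyElem_mem : polyElem τ B z n f ∈ affPlus τ B z n := by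
  refine Subalgebra.sum_mem _ fun m _ => Subalgebra.mul_mem _ ?_ (Subalgebra.pow_mem _ ?_ m)
  · exact Algebra.subset_adjoin (Or.inl ⟨_, rfl⟩)
  · exact Algebra.subset_adjoin (Or.inr ⟨0, rfl⟩)

/-- The two-sided ideal `⟨f⟩` of `H_n^aff(A, z)` generated by `f`. -/
def cycIdeal : TwoSidedIdeal (Aff τ B z n) := TwoSidedIdeal.span {polyElem τ B z n f}

/-- The two-sided ideal `⟨f⟩_+` of `H_{n,+}^aff(A, z)` generated by `f`. -/
def cycIdealPlus : TwoSidedIdeal (affPlus τ B z n) :=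
  TwoSidedIdeal.span {⟨polyElem τ B z n f, polyElem_mem τ B z n f⟩}

/-- The quantum cyclotomic wreath algebra `H_n^f(A, z) = H_n^aff(A, z) / ⟨f⟩`. -/
abbrev Cyc : Type (max u v) := (cycIdeal τ B z n f).ringCon.Quotient

/-- `H_{n,+}^f(A, z) = H_{n,+}^aff(A, z) / ⟨f⟩_+`. -/
abbrev CycPlus : Type (max u v) := (cycIdealPlus τ B z n f).ringCon.Quotient

/-- The projection `H_n^aff(A, z) → H_n^f(A, z)`. -/
def cycMk : Aff τ B z n →ₐ[k] Cyc τ B z n f := RingCon.mkₐ k (cycIdeal τ B z n f).ringCon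

/-- The projection `H_{n,+}^aff(A, z) → H_{n,+}^f(A, z)`. -/
def cycPlusMk : affPlus τ B z n →ₐ[k] CycPlus τ B z n f :=
  RingCon.mkₐ k (cycIdealPlus τ B z n f).ringCon

/-- The composite `η` of the inclusion `H_{n,+}^aff(A, z) → H_n^aff(A, z)` and the projection
`H_n^aff(A, z) → H_n^f(A, z)`. -/
def eta : affPlus τ B z n →ₐ[k] Cyc τ B z n f := (cycMk τ B z n f).comp (affPlus τ B z n).val

/-- The part of parity `p` of the superalgebra `H_n^f(A, z)`. -/
def cycPart (p : ZMod 2) : Submodule k (Cyc τ B z n f) :=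
  (Aff.part τ B z n p).map (cycMk τ B z n f).toLinearMap

/-- The part of parity `p` of the superalgebra `H_{n,+}^f(A, z)`. -/
def cycPlusPart (p : ZMod 2) : Submodule k (CycPlus τ B z n f) :=
  ((Aff.part τ B z n p).comap (affPlus τ B z n).val.toLinearMap).map
    (cycPlusMk τ B z n f).toLinearMap

end Hecke

end QuantumWreath

end

open QuantumWreath

/-! The only thing separating the two quotients is the invertibility of the `X_i`, and this already
holds modulo `f` in the smaller algebra. Write `f = g X_1 + a_(0)` with `g = f.divX`. Since `a_(0)`
is a unit, `-g a_(0)⁻¹` becomes a two-sided inverse of `X_1` modulo `f`. Each `T_i` is invertible in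
the subalgebra and `X_{i+1} = T_i X_i T_i`, so the invertibility spreads to every `X_i`
(`exists_inverse_X`).

The presentation of `H_n^aff` therefore extends the projection `H_{n,+}^aff → H_{n,+}^f` to a
homomorphism `φ` on all of `H_n^aff` (`exists_extension`). As `φ` kills `f`, it kills `⟨f⟩`;
restricted to the subalgebra this gives both the injectivity of the map induced by `η` and the
nontrivial inclusion between the ideals. Composing `φ` with that map gives the projection onto
`H_n^f`, whence surjectivity. No basis theorem for `H_n^aff` is needed.

For the grading, the inverses must be even. As `T_i⁻¹ = T_i - z t_{i,i+1}`, this comes down to the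
evenness of the teleporter (`ofWreath_teleporter_mem_part`), which takes an argument because the
basis `B` need not be homogeneous. Homogeneous elements of `H_n^f` then have homogeneous
representatives in the subalgebra (`exists_homogeneous_lift`). -/

noncomputable section

namespace QuantumWreath

open scoped TensorProduct

universe u v w u'

/-! ### Universal properties of free products and Laurent polynomial algebras. -/

section Lifts

variable {k : Type u} [CommRing k]

namespace FreeProd

variable {R : Type v} {S : Type w} {C : Type u'} [Ring R] [Ring S] [Ring C]
  [Algebra k R] [Algebra k S] [Algebra k C]

/-- The universal property of the free product. -/
def lift (g : R →ₐ[k] C) (h : S →ₐ[k] C) : FreeProd k R S →ₐ[k] C :=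
  RingQuot.liftAlgHom k ⟨FreeAlgebra.lift k (Sum.elim g h), by
    intro x y hxy
    induction hxy <;> simp⟩

@[simp] lemma lift_inl (g : R →ₐ[k] C) (h : S →ₐ[k] C) (x : R) :
    lift g h (inl k R S x) = g x := by
  change RingQuot.liftAlgHom k _ (RingQuot.mkAlgHom k _ _) = _
  rw [RingQuot.liftAlgHom_mkAlgHom_apply]
  simp

@[simp] lemma lift_inr (g : R →ₐ[k] C) (h : S →ₐ[k] C) (x : S) :
    lift g h (inr k R S x) = h x := by
  change RingQuot.liftAlgHom k _ (RingQuot.mkAlgHom k _ _) = _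
  rw [RingQuot.liftAlgHom_mkAlgHom_apply]
  simp

lemma algHom_ext {φ ψ : FreeProd k R S →ₐ[k] C} (hl : ∀ x, φ (inl k R S x) = ψ (inl k R S x))
    (hr : ∀ x, φ (inr k R S x) = ψ (inr k R S x)) : φ = ψ := by
  refine RingQuot.ringQuot_ext' (S := k) (A := FreeAlgebra k (R ⊕ S)) φ ψ
    (FreeAlgebra.hom_ext (funext fun x => ?_))
  rcases x with x | x
  · exact hl x
  · exact hr x

end FreeProd

namespace Laurent

variable {n : ℕ} {C : Type v} [Ring C] [Algebra k C]

lemma pairwise_commute_zpowersHom {G : Type v} [Group G] {x : Fin n → G}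
    (hx : Pairwise fun i j => Commute (x i) (x j)) :
    Pairwise fun i j => ∀ a b, Commute (zpowersHom G (x i) a) (zpowersHom G (x j) b) :=
  fun _ _ hij a b => by simpa using (hx hij).zpow_zpow _ _

/-- The homomorphism from `ℤ^n` given by pairwise commuting elements of a group. -/
def monomialHom {G : Type v} [Group G] (x : Fin n → G)
    (hx : Pairwise fun i j => Commute (x i) (x j)) : Multiplicative (Fin n →₀ ℤ) →* G where
  toFun m := MonoidHom.noncommPiCoprod (fun i => zpowersHom G (x i))
    (pairwise_commute_zpowersHom hx) fun i => Multiplicative.ofAdd (m.toAdd i)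
  map_one' := map_one (MonoidHom.noncommPiCoprod _ (pairwise_commute_zpowersHom hx))
  map_mul' _ _ := map_mul (MonoidHom.noncommPiCoprod _ (pairwise_commute_zpowersHom hx)) _ _

lemma monomialHom_single {G : Type v} [Group G] (x : Fin n → G)
    (hx : Pairwise fun i j => Commute (x i) (x j)) (i : Fin n) (m : ℤ) :
    monomialHom x hx (Multiplicative.ofAdd (Finsupp.single i m)) = x i ^ m := by
  change MonoidHom.noncommPiCoprod (fun i => zpowersHom G (x i)) (pairwise_commute_zpowersHom hx)
    (fun j => Multiplicative.ofAdd ((Multiplicative.ofAdd (Finsupp.single i m)).toAdd j)) = _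
  -- The exponent vector is supported at `i`, so the noncommutative product collapses to one factor.
  have : (fun j => Multiplicative.ofAdd ((Multiplicative.ofAdd (Finsupp.single i m)).toAdd j)) =
      (Pi.mulSingle i (Multiplicative.ofAdd m) : Fin n → Multiplicative ℤ) := by
    funext j
    by_cases h : j = i
    · subst h; simp
    · simp [h]
  rw [this, MonoidHom.noncommPiCoprod_mulSingle]
  simp

/-- The algebra homomorphism from Laurent polynomials given by pairwise commuting units. -/
def lift (x : Fin n → Cˣ) (hx : Pairwise fun i j => Commute (x i) (x j)) :
    Laurent k n →ₐ[k] C :=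
  AddMonoidAlgebra.lift k C (Fin n →₀ ℤ) ((Units.coeHom C).comp (monomialHom x hx))

lemma lift_X (x : Fin n → Cˣ) (hx : Pairwise fun i j => Commute (x i) (x j)) (i : Fin n) (m : ℤ) :
    lift (k := k) x hx (X k i m) = ((x i ^ m : Cˣ) : C) := by
  rw [lift, X, AddMonoidAlgebra.lift_single, one_smul, MonoidHom.comp_apply, monomialHom_single]
  rfl

lemma X_mul_X (i : Fin n) (a b : ℤ) : X k i a * X k i b = X k i (a + b) := by
  simp [X, AddMonoidAlgebra.single_mul_single]

lemma X_zero (i : Fin n) : X k i 0 = 1 := by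
  simp [X, AddMonoidAlgebra.one_def]

lemma X_pow (i : Fin n) (m : ℕ) : X k i 1 ^ m = X k i m := by
  induction m with
  | zero => simp [X_zero]
  | succ m ih => rw [pow_succ, ih, X_mul_X]; simp

/-- Negative powers need no separate hypothesis: inverses are unique, so agreement on `X_i^m` forces
agreement on `X_i^{-m}`. -/
lemma algHom_ext {φ ψ : Laurent k n →ₐ[k] C} (h : ∀ i, φ (X k i 1) = ψ (X k i 1)) : φ = ψ := by
  refine AddMonoidAlgebra.algHom_ext (R := k) (A := k) (M := Fin n →₀ ℤ) (fun m => ?_)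
    (Subsingleton.elim _ _)
  have key : ∀ (i : Fin n) (m : ℤ), φ (X k i m) = ψ (X k i m) := by
    have hpow : ∀ (i : Fin n) (m : ℕ), φ (X k i m) = ψ (X k i m) := by
      intro i m
      rw [← X_pow, map_pow, map_pow, h]
    intro i m
    obtain ⟨m, rfl | rfl⟩ := m.eq_nat_or_neg
    · exact hpow i m
    · have h1 : ψ (X k i (-m)) * φ (X k i m) = 1 := by
        rw [hpow, ← map_mul, X_mul_X]; simp [X_zero]
      have h2 : φ (X k i m) * φ (X k i (-m)) = 1 := by
        rw [← map_mul, X_mul_X]; simp [X_zero]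
      exact (left_inv_eq_right_inv h1 h2).symm
  induction m using Finsupp.induction with
  | zero => exact (map_one φ).trans (map_one ψ).symm
  | single_add i a m _ _ ih =>
    have : (AddMonoidAlgebra.single (Finsupp.single i a + m) 1 : Laurent k n) =
        X k i a * AddMonoidAlgebra.single m 1 := by
      simp [X, AddMonoidAlgebra.single_mul_single]
    rw [this, map_mul, map_mul, ih, key]

end Laurent

end Lifts

/-! ### Trace duality, evenness of the teleporter, and relations in the affine algebra. -/

section Teleporter

variable {k : Type u} {A : Type v} [CommRing k] [Ring A] [Algebra k A]
  {𝒜 : ZMod 2 → Submodule k A} (τ : SuperTrace 𝒜) {ι : Type w} (B : Module.Basis ι k A)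

namespace SuperTrace

lemma tr_dual_mul_eq_coord (s : ι) (a : A) : τ.tr (τ.dual B s * a) = B.coord s a := by
  change τ.toDual (τ.dual B s) a = _
  rw [dual, LinearEquiv.apply_symm_apply]

/-- By nondegeneracy of the trace form it suffices to pair both sides with the basis `B`. -/
lemma sum_tr_mul_smul_dual [Fintype ι] (x : A) : ∑ t, τ.tr (x * B t) • τ.dual B t = x := by
  apply τ.toDual.injective
  refine B.ext fun s => ?_
  classical
  change τ.tr ((∑ t, τ.tr (x * B t) • τ.dual B t) * B s) = τ.tr (x * B s)
  simp [Finset.sum_mul, tr_dual_mul]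

variable [GradedAlgebra 𝒜]

/-- Components of different parity multiply to an odd element, on which the trace vanishes. Together
with `tr_mul_proj` this makes each parity projection self-adjoint for the trace form. -/
lemma tr_proj_mul (q : ZMod 2) (x y : A) :
    τ.tr (GradedAlgebra.proj 𝒜 q x * y) =
      τ.tr (GradedAlgebra.proj 𝒜 q x * GradedAlgebra.proj 𝒜 q y) := by
  have hodd : ∀ r, r ≠ q → τ.tr (GradedAlgebra.proj 𝒜 q x * GradedAlgebra.proj 𝒜 r y) = 0 := by
    intro r hr
    have h1 : q + r = 1 := by revert q r; decide
    refine τ.even _ ?_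
    rw [← h1]
    exact SetLike.mul_mem_graded (SetLike.coe_mem _) (SetLike.coe_mem _)
  conv_lhs => rw [← proj_sum 𝒜 y]
  rw [Finset.mul_sum, map_sum, Finset.sum_eq_single q (fun r _ hr => hodd r hr) (by simp)]

lemma tr_mul_proj (q : ZMod 2) (x y : A) :
    τ.tr (x * GradedAlgebra.proj 𝒜 q y) =
      τ.tr (GradedAlgebra.proj 𝒜 q x * GradedAlgebra.proj 𝒜 q y) := by
  have hodd : ∀ r, r ≠ q → τ.tr (GradedAlgebra.proj 𝒜 r x * GradedAlgebra.proj 𝒜 q y) = 0 := by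
    intro r hr
    have h1 : r + q = 1 := by revert q r; decide
    refine τ.even _ ?_
    rw [← h1]
    exact SetLike.mul_mem_graded (SetLike.coe_mem _) (SetLike.coe_mem _)
  conv_lhs => rw [← proj_sum 𝒜 x]
  rw [Finset.sum_mul, map_sum, Finset.sum_eq_single q (fun r _ hr => hodd r hr) (by simp)]

/-- The canonical tensor `∑ b ⊗ b^∨` lets an operator on the second factor be moved to the first as
its adjoint, and parity projections are self-adjoint. The bilinear map `β` stands in for the tensor
product. -/
lemma sum_bilin_proj_dual [Fintype ι] {M : Type u'} [AddCommGroup M] [Module k M]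
    (β : A →ₗ[k] A →ₗ[k] M)
    (p q : ZMod 2) :
    ∑ s, β (GradedAlgebra.proj 𝒜 p (B s)) (GradedAlgebra.proj 𝒜 q (τ.dual B s)) =
      ∑ t, β (GradedAlgebra.proj 𝒜 p (GradedAlgebra.proj 𝒜 q (B t))) (τ.dual B t) := by
  have h1 : ∀ s, GradedAlgebra.proj 𝒜 q (τ.dual B s) =
      ∑ t, B.coord s (GradedAlgebra.proj 𝒜 q (B t)) • τ.dual B t := by
    intro s
    conv_lhs => rw [← τ.sum_tr_mul_smul_dual B (GradedAlgebra.proj 𝒜 q (τ.dual B s))]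
    refine Finset.sum_congr rfl fun t _ => ?_
    rw [tr_proj_mul, ← tr_mul_proj, tr_dual_mul_eq_coord]
  have h2 : ∀ t, GradedAlgebra.proj 𝒜 p (GradedAlgebra.proj 𝒜 q (B t)) =
      ∑ s, B.coord s (GradedAlgebra.proj 𝒜 q (B t)) • GradedAlgebra.proj 𝒜 p (B s) := by
    intro t
    conv_lhs => rw [← B.sum_repr (GradedAlgebra.proj 𝒜 q (B t))]
    simp only [map_sum, map_smul, Module.Basis.coord_apply]
  simp only [h1, h2, map_sum, map_smul, LinearMap.sum_apply, LinearMap.smul_apply]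
  exact Finset.sum_comm

end SuperTrace

variable [GradedAlgebra 𝒜] [Fintype ι] (z : k) (n : ℕ)

namespace Aff

variable {τ B z n}

lemma mul_mem_part {p q : ZMod 2} {x y : Aff τ B z n} (hx : x ∈ part τ B z n p)
    (hy : y ∈ part τ B z n q) : x * y ∈ part τ B z n (p + q) := IsHomogeneous.mul hx hy

lemma mul_mem_part_zero {x y : Aff τ B z n} (hx : x ∈ part τ B z n 0)
    (hy : y ∈ part τ B z n 0) : x * y ∈ part τ B z n 0 := by simpa using mul_mem_part hx hy

lemma one_mem_part : (1 : Aff τ B z n) ∈ part τ B z n 0 := by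
  simpa using! (IsHomogeneous.scalar (1 : k) : IsHomogeneous τ B z n 0 _)

lemma pow_mem_part_zero {x : Aff τ B z n} (hx : x ∈ part τ B z n 0) (m : ℕ) :
    x ^ m ∈ part τ B z n 0 := by
  induction m with
  | zero => simpa using one_mem_part
  | succ m ih => rw [pow_succ]; exact mul_mem_part_zero ih hx

/-- Neither `b` nor `b^∨` need be homogeneous, so evenness holds only for the whole sum, after
splitting both factors into parity components. -/
lemma ofWreath_teleporter_mem_part (i j : Fin n) :
    ofWreath τ B z n (Wreath.of τ B z n (τ.teleporter B i j)) ∈ part τ B z n 0 := by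
  let β : A →ₗ[k] A →ₗ[k] Aff τ B z n := (LinearMap.mul k (Aff τ B z n)).compl₁₂
    (single τ B z i).toLinearMap (single τ B z j).toLinearMap
  have hβ : ofWreath τ B z n (Wreath.of τ B z n (τ.teleporter B i j)) =
      ∑ s, β (B s) (τ.dual B s) := by
    simp only [SuperTrace.teleporter, map_sum, map_mul]
    rfl
  have key : ∑ s, β (B s) (τ.dual B s) = ∑ p, ∑ q, ∑ s,
      β (GradedAlgebra.proj 𝒜 p (B s)) (GradedAlgebra.proj 𝒜 q (τ.dual B s)) := by
    have : ∀ s, β (B s) (τ.dual B s) = ∑ p, ∑ q,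
        β (GradedAlgebra.proj 𝒜 p (B s)) (GradedAlgebra.proj 𝒜 q (τ.dual B s)) := by
      intro s
      conv_lhs => rw [← proj_sum 𝒜 (B s), ← proj_sum 𝒜 (τ.dual B s)]
      simp only [map_sum, LinearMap.sum_apply]
      exact Finset.sum_comm
    simp only [this]
    rw [Finset.sum_comm]
    exact Finset.sum_congr rfl fun p _ => Finset.sum_comm
  rw [hβ, key]
  refine Submodule.sum_mem _ fun p _ => Submodule.sum_mem _ fun q _ => ?_
  -- Equal parities give even products, as `p + p = 0`. For distinct parities the terms are not
  -- individually zero; the sum over `s` vanishes since both projections can be moved onto the same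
  -- factor.
  by_cases hpq : p = q
  · subst hpq
    refine Submodule.sum_mem _ fun s _ => ?_
    have h := mul_mem_part (τ := τ) (B := B) (z := z)
      (IsHomogeneous.single i p (GradedAlgebra.proj 𝒜 p (B s)) (SetLike.coe_mem _))
      (IsHomogeneous.single j p (GradedAlgebra.proj 𝒜 p (τ.dual B s)) (SetLike.coe_mem _))
    rwa [CharTwo.add_self_eq_zero] at h
  · rw [SuperTrace.sum_bilin_proj_dual]
    simp [-GradedAlgebra.proj_apply, proj_proj, hpq]

variable (τ B z)

lemma X_mul_X (i : Fin n) (a b : ℤ) : X τ B z i a * X τ B z i b = X τ B z i (a + b) := by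
  rw [X, X, ← map_mul, Laurent.X_mul_X]; rfl

lemma X_zero (i : Fin n) : X τ B z i 0 = 1 := by rw [X, Laurent.X_zero, map_one]

lemma X_pow (i : Fin n) (m : ℕ) : X τ B z i 1 ^ m = X τ B z i m := by
  rw [X, ← map_pow, Laurent.X_pow]; rfl

lemma X_commute (i j : Fin n) : Commute (X τ B z i 1) (X τ B z j 1) :=
  (Commute.all (Laurent.X k i 1) (Laurent.X k j 1)).map (ofLaurent τ B z n)

lemma X_commute_of (i : Fin n) (a : SuperPower 𝒜 n) :
    Commute (X τ B z i 1) (ofWreath τ B z n (Wreath.of τ B z n a)) := by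
  have h := RingQuot.mkAlgHom_rel k (Rel.pna (τ := τ) (B := B) (z := z) i a)
  rw [map_mul, map_mul] at h
  exact h

lemma T_mul_X {i : Fin (n - 1)} {j : Fin n} (h : j ≠ lo i) (h' : j ≠ hi i) :
    T τ B z i * X τ B z j 1 = X τ B z j 1 * T τ B z i := by
  have h := RingQuot.mkAlgHom_rel k (Rel.commute (τ := τ) (B := B) (z := z) i j h h')
  rw [map_mul, map_mul] at h
  exact h

lemma T_mul_X_mul_T (i : Fin (n - 1)) :
    T τ B z i * X τ B z (lo i) 1 * T τ B z i = X τ B z (hi i) 1 := by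
  have h := RingQuot.mkAlgHom_rel k (Rel.inverse (τ := τ) (B := B) (z := z) i)
  rw [map_mul, map_mul] at h
  exact h

/-- The inverse of `T_i`. -/
def invT (i : Fin (n - 1)) : Aff τ B z n :=
  T τ B z i - z • ofWreath τ B z n (Wreath.of τ B z n (τ.teleporter B (lo i) (hi i)))

/-- This is the quadratic relation rearranged: the teleporter stands to the left of `T_i` there, so
only a left inverse is obtained directly. -/
lemma invT_mul_T (i : Fin (n - 1)) : invT τ B z i * T τ B z i = 1 := by
  have h : Wreath.T τ B z i ^ 2 = z • (Wreath.of τ B z n (τ.teleporter B (lo i) (hi i)) *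
      Wreath.T τ B z i) + 1 := by
    have h := RingQuot.mkAlgHom_rel k (Wreath.Rel.quadratic (τ := τ) (B := B) (z := z) i)
    rw [map_pow, map_add, map_smul, map_mul, map_one] at h
    exact h
  have h' := congrArg (ofWreath τ B z n) h
  rw [map_pow, map_add, map_smul, map_mul, map_one, pow_two] at h'
  rw [invT, sub_mul, smul_mul_assoc]
  exact sub_eq_of_eq_add' h'

lemma T_mul_invT (i : Fin (n - 1)) : T τ B z i * invT τ B z i = 1 := by
  -- A right inverse comes from `T_i X_i T_i = X_{i+1}` and the invertibility of `X_{i+1}`. It must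
  -- agree with the left inverse, so no commutation of `T_i` with the teleporter is needed.
  have h : T τ B z i * (X τ B z (lo i) 1 * T τ B z i * X τ B z (hi i) (-1)) = 1 := by
    rw [← mul_assoc, ← mul_assoc, T_mul_X_mul_T, X_mul_X, add_neg_cancel, X_zero]
  rw [left_inv_eq_right_inv (invT_mul_T τ B z i) h, h]

lemma T_mem_part (i : Fin (n - 1)) : T τ B z i ∈ part τ B z n 0 := IsHomogeneous.T i

lemma invT_mem_part (i : Fin (n - 1)) : invT τ B z i ∈ part τ B z n 0 :=
  Submodule.sub_mem _ (T_mem_part τ B z i)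
    (Submodule.smul_mem _ _ (ofWreath_teleporter_mem_part _ _))

/-- The algebra homomorphism from `H_n^aff(A, z)` given by a homomorphism from `H_n(A, z)` and the
images of the `X_i`. -/
def lift {C : Type u'} [Ring C] [Algebra k C] (g : Wreath τ B z n →ₐ[k] C) (x : Fin n → Cˣ)
    (hx : Pairwise fun i j => Commute (x i) (x j))
    (hcomm : ∀ (i : Fin (n - 1)) (j : Fin n), j ≠ lo i → j ≠ hi i →
      g (Wreath.T τ B z i) * x j = x j * g (Wreath.T τ B z i))
    (hinv : ∀ i : Fin (n - 1),
      g (Wreath.T τ B z i) * x (lo i) * g (Wreath.T τ B z i) = x (hi i))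
    (hof : ∀ (i : Fin n) (a : SuperPower 𝒜 n),
      x i * g (Wreath.of τ B z n a) = g (Wreath.of τ B z n a) * x i) :
    Aff τ B z n →ₐ[k] C :=
  RingQuot.liftAlgHom k ⟨FreeProd.lift (Laurent.lift x hx) g, by
    intro a b hab
    induction hab with
    | commute i j h h' =>
      simpa [PreAff.T, PreAff.X, Laurent.lift_X] using hcomm i j h h'
    | inverse i => simpa [PreAff.T, PreAff.X, Laurent.lift_X] using hinv i
    | pna i a => simpa [PreAff.of, PreAff.X, Laurent.lift_X] using hof i a⟩

section lift

variable {C : Type u'} [Ring C] [Algebra k C] (g : Wreath τ B z n →ₐ[k] C) (x : Fin n → Cˣ)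
    (hx : Pairwise fun i j => Commute (x i) (x j))
    (hcomm : ∀ (i : Fin (n - 1)) (j : Fin n), j ≠ lo i → j ≠ hi i →
      g (Wreath.T τ B z i) * x j = x j * g (Wreath.T τ B z i))
    (hinv : ∀ i : Fin (n - 1),
      g (Wreath.T τ B z i) * x (lo i) * g (Wreath.T τ B z i) = x (hi i))
    (hof : ∀ (i : Fin n) (a : SuperPower 𝒜 n),
      x i * g (Wreath.of τ B z n a) = g (Wreath.of τ B z n a) * x i)

lemma lift_ofWreath (y : Wreath τ B z n) :
    lift τ B z g x hx hcomm hinv hof (ofWreath τ B z n y) = g y := by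
  change RingQuot.liftAlgHom k _ (RingQuot.mkAlgHom k _ _) = _
  rw [RingQuot.liftAlgHom_mkAlgHom_apply]
  exact FreeProd.lift_inr _ _ _

lemma lift_X (i : Fin n) (m : ℤ) :
    lift τ B z g x hx hcomm hinv hof (X τ B z i m) = ((x i ^ m : Cˣ) : C) := by
  change RingQuot.liftAlgHom k _ (RingQuot.mkAlgHom k _ _) = _
  rw [RingQuot.liftAlgHom_mkAlgHom_apply]
  exact (FreeProd.lift_inl _ _ _).trans (Laurent.lift_X _ _ _ _)

variable {τ B z}

lemma algHom_ext {φ ψ : Aff τ B z n →ₐ[k] C}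
    (hw : ∀ y, φ (ofWreath τ B z n y) = ψ (ofWreath τ B z n y))
    (hX : ∀ i, φ (X τ B z i 1) = ψ (X τ B z i 1)) : φ = ψ := by
  refine RingQuot.ringQuot_ext' (S := k) (A := PreAff τ B z n) φ ψ
    (FreeProd.algHom_ext (fun x => ?_) hw)
  exact DFunLike.congr_fun (Laurent.algHom_ext
    (φ := φ.comp (ofLaurent τ B z n)) (ψ := ψ.comp (ofLaurent τ B z n)) hX) x

end lift

end Aff

end Teleporter

/-! ### The two cyclotomic quotients and the comparison between them. -/

section Cyclotomic

variable {k : Type u} {A : Type v} [CommRing k] [Ring A] [Algebra k A]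
  {𝒜 : ZMod 2 → Submodule k A}

/-- The inverse of a homogeneous unit of degree zero has degree zero. -/
lemma inv_mem_zero [GradedAlgebra 𝒜] {a b : A} (ha : a ∈ 𝒜 0) (hab : a * b = 1) (hba : b * a = 1) :
    b ∈ 𝒜 0 := by
  -- Taking the even component of `a b = 1` shows that the even component of `b` is also a right
  -- inverse of `a`, hence equal to `b`.
  have h : GradedAlgebra.proj 𝒜 0 (a * b) = a * GradedAlgebra.proj 𝒜 0 b := by
    simp only [GradedAlgebra.proj_apply]
    exact DirectSum.coe_decompose_mul_of_left_mem_zero 𝒜 ha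
  rw [hab, proj_one, if_pos rfl] at h
  rw [left_inv_eq_right_inv hba h.symm]
  exact SetLike.coe_mem _

variable [GradedAlgebra 𝒜] (τ : SuperTrace 𝒜)
  {ι : Type w} [Fintype ι] (B : Module.Basis ι k A) (z : k) (n : ℕ)

namespace affPlus

/-- The natural map `H_n(A, z) → H_{n,+}^aff(A, z)`. -/
def ofWreath : Wreath τ B z n →ₐ[k] affPlus τ B z n :=
  (Aff.ofWreath τ B z n).codRestrict _ fun y => Algebra.subset_adjoin (Or.inl ⟨y, rfl⟩)

variable {n}

/-- The element `X_i` of `H_{n,+}^aff(A, z)`. -/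
def X (i : Fin n) : affPlus τ B z n :=
  ⟨Aff.X τ B z i 1, Algebra.subset_adjoin (Or.inr ⟨i, rfl⟩)⟩

variable {τ B z}

lemma algHom_ext {C : Type u'} [Ring C] [Algebra k C] {φ ψ : affPlus τ B z n →ₐ[k] C}
    (hw : ∀ y, φ (ofWreath τ B z n y) = ψ (ofWreath τ B z n y))
    (hX : ∀ i, φ (X τ B z i) = ψ (X τ B z i)) : φ = ψ := by
  refine AlgHom.adjoin_ext ?_
  rintro x (⟨y, rfl⟩ | ⟨i, rfl⟩)
  · exact hw y
  · exact hX i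

/-- The formula for `T_i⁻¹` involves only `H_n(A, z)`, so inverting `T_i` requires no negative power
of any `X_j`. -/
lemma invT_mem (i : Fin (n - 1)) : Aff.invT τ B z i ∈ affPlus τ B z n :=
  Subalgebra.sub_mem _ (ofWreath τ B z n (Wreath.T τ B z i)).2
    (Subalgebra.smul_mem _ (ofWreath τ B z n (Wreath.of τ B z n _)).2 z)

end affPlus

variable {n}

lemma X_commute_single (i : Fin n) (a : A) :
    Commute (Aff.X τ B z i 1) (Aff.single τ B z i a) := Aff.X_commute_of τ B z i _

variable [NeZero n] (f : Polynomial A)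

lemma polyElem_eq_eval₂ : polyElem τ B z n f =
    f.eval₂ (Aff.single τ B z (0 : Fin n) : A →+* Aff τ B z n) (Aff.X τ B z (0 : Fin n) 1) := by
  rw [Polynomial.eval₂_eq_sum]; rfl

/-- Every coefficient and every power of `X_1` commutes with `X_1`. Applied to `f.divX`, this turns
a left inverse of `X_1` into a two-sided one. -/
lemma X_commute_polyElem : Commute (Aff.X τ B z (0 : Fin n) 1) (polyElem τ B z n f) :=
  Commute.sum_right _ _ _ fun _ _ =>
    (X_commute_single τ B z 0 _).mul_right ((Commute.refl _).pow_right _)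

/-- Isolates the invertible constant term. With `X_1` on the right, evaluation is multiplicative
without any commutation hypothesis. -/
lemma polyElem_eq_divX : polyElem τ B z n f =
    polyElem τ B z n f.divX * Aff.X τ B z (0 : Fin n) 1 + Aff.single τ B z 0 (f.coeff 0) := by
  conv_lhs => rw [polyElem_eq_eval₂, ← Polynomial.divX_mul_X_add f]
  rw [Polynomial.eval₂_add, Polynomial.eval₂_C, Polynomial.eval₂_mul_X, ← polyElem_eq_eval₂]
  rfl

lemma polyElem_mem_part (hf : ∀ m, f.coeff m ∈ 𝒜 0) :
    polyElem τ B z n f ∈ Aff.part τ B z n 0 :=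
  Submodule.sum_mem _ fun m _ => Aff.mul_mem_part_zero (Aff.IsHomogeneous.single _ _ _ (hf m))
    (Aff.pow_mem_part_zero (Aff.IsHomogeneous.X _ _) m)

lemma cycPlusMk_eq_zero {x : affPlus τ B z n} :
    cycPlusMk τ B z n f x = 0 ↔ x ∈ cycIdealPlus τ B z n f := by
  rw [TwoSidedIdeal.mem_iff]
  exact RingCon.eq _

lemma cycMk_eq_zero {x : Aff τ B z n} : cycMk τ B z n f x = 0 ↔ x ∈ cycIdeal τ B z n f := by
  rw [TwoSidedIdeal.mem_iff]
  exact RingCon.eq _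

lemma cycPlusMk_polyElem :
    cycPlusMk τ B z n f ⟨polyElem τ B z n f, polyElem_mem τ B z n f⟩ = 0 :=
  (cycPlusMk_eq_zero τ B z f).2 (TwoSidedIdeal.subset_span rfl)

lemma cycMk_polyElem : cycMk τ B z n f (polyElem τ B z n f) = 0 :=
  (cycMk_eq_zero τ B z f).2 (TwoSidedIdeal.subset_span rfl)

variable {f}

/-- Modulo `f`, the elements `X_i` have even inverses in `H_{n,+}^aff(A, z)`. -/
lemma exists_inverse_X (hf : ∀ m, f.coeff m ∈ 𝒜 0) (hunit : IsUnit (f.coeff 0)) (i : Fin n) :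
    ∃ y : affPlus τ B z n, (y : Aff τ B z n) ∈ Aff.part τ B z n 0 ∧
      cycPlusMk τ B z n f (affPlus.X τ B z i * y) = 1 ∧
      cycPlusMk τ B z n f (y * affPlus.X τ B z i) = 1 := by
  obtain ⟨i, hi⟩ := i
  induction i with
  | zero =>
    have h0 : (⟨0, hi⟩ : Fin n) = 0 := rfl
    rw [h0]
    obtain ⟨b, hab, hba⟩ : ∃ b, f.coeff 0 * b = 1 ∧ b * f.coeff 0 = 1 :=
      isUnit_iff_exists.1 hunit
    have hb : b ∈ 𝒜 0 := inv_mem_zero (hf 0) hab hba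
    let s : A → affPlus τ B z n := fun a => affPlus.ofWreath τ B z n
      (Wreath.of τ B z n (SuperPower.single 𝒜 0 a))
    let g : affPlus τ B z n := ⟨_, polyElem_mem τ B z n f.divX⟩
    have hXs : Commute (affPlus.X τ B z 0) (s b) := Subtype.ext (X_commute_single τ B z 0 b)
    have hXg : Commute (affPlus.X τ B z 0) g := Subtype.ext (X_commute_polyElem τ B z f.divX)
    have hs : s (f.coeff 0) * s b = 1 := by
      simp only [s, ← map_mul, hab, map_one]
    have hfg : cycPlusMk τ B z n f (g * affPlus.X τ B z 0 + s (f.coeff 0)) = 0 := by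
      rw [← cycPlusMk_polyElem τ B z f]
      exact congrArg _ (Subtype.ext (polyElem_eq_divX τ B z f).symm)
    -- Multiplying `f = g X_1 + a_(0)` on the right by `b = a_(0)⁻¹` and commuting `b` past `X_1`
    -- gives `f b = g b X_1 + 1`, which is zero modulo `f`.
    have hy : cycPlusMk τ B z n f (-(g * s b) * affPlus.X τ B z 0) = 1 := by
      have h : -(g * s b) * affPlus.X τ B z 0 =
          1 - (g * affPlus.X τ B z 0 + s (f.coeff 0)) * s b := by
        rw [add_mul, hs, neg_mul, mul_assoc g, ← hXs.eq, mul_assoc g]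
        abel
      rw [h, map_sub, map_mul, hfg, zero_mul, sub_zero, map_one]
    refine ⟨-(g * s b), Submodule.neg_mem _ (Aff.mul_mem_part_zero ?_ ?_), ?_, hy⟩
    · exact polyElem_mem_part τ B z _ fun m => by rw [Polynomial.coeff_divX]; exact hf _
    · exact Aff.IsHomogeneous.single _ _ _ hb
    · rw [((hXg.mul_right hXs).neg_right).eq, hy]
  | succ i ih =>
    obtain ⟨y, hy0, hy1, hy2⟩ := ih (by omega)
    let j : Fin (n - 1) := ⟨i, by omega⟩
    let T : affPlus τ B z n := affPlus.ofWreath τ B z n (Wreath.T τ B z j)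
    let L : affPlus τ B z n := ⟨_, affPlus.invT_mem (τ := τ) (B := B) (z := z) j⟩
    have hTL : T * L = 1 := Subtype.ext (Aff.T_mul_invT τ B z j)
    have hLT : L * T = 1 := Subtype.ext (Aff.invT_mul_T τ B z j)
    have hX : affPlus.X τ B z ⟨i + 1, hi⟩ = T * affPlus.X τ B z ⟨i, by omega⟩ * T :=
      Subtype.ext (Aff.T_mul_X_mul_T τ B z j).symm
    -- Invert `X_{i+1} = T_i X_i T_i` factor by factor, with `L = T_i⁻¹`. The cancellations of `T_i`
    -- hold before passing to the quotient; only that of `X_i` against `y` holds modulo `f`.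
    refine ⟨L * y * L, Aff.mul_mem_part_zero (Aff.mul_mem_part_zero (Aff.invT_mem_part τ B z j) hy0)
      (Aff.invT_mem_part τ B z j), ?_, ?_⟩
    · have h : affPlus.X τ B z ⟨i + 1, hi⟩ * (L * y * L) =
          T * (affPlus.X τ B z ⟨i, by omega⟩ * y) * L := by
        rw [hX]
        calc _ = T * affPlus.X τ B z ⟨i, by omega⟩ * (T * L) * y * L := by noncomm_ring
          _ = _ := by rw [hTL]; noncomm_ring
      rw [h, map_mul, map_mul, hy1, mul_one, ← map_mul, hTL, map_one]
    · have h : L * y * L * affPlus.X τ B z ⟨i + 1, hi⟩ =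
          L * (y * affPlus.X τ B z ⟨i, by omega⟩) * T := by
        rw [hX]
        calc _ = L * y * (L * T) * affPlus.X τ B z ⟨i, by omega⟩ * T := by noncomm_ring
          _ = _ := by rw [hLT]; noncomm_ring
      rw [h, map_mul, map_mul, hy2, mul_one, ← map_mul, hLT, map_one]

variable (n f) in
/-- The homomorphism `H_{n,+}^f(A, z) → H_n^f(A, z)` induced by `η`. -/
def etaBar : CycPlus τ B z n f →ₐ[k] Cyc τ B z n f :=
  RingCon.liftₐ _ (eta τ B z n f) <| by
    have h : cycIdealPlus τ B z n f ≤ TwoSidedIdeal.ker (eta τ B z n f) := by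
      refine TwoSidedIdeal.span_le.2 ?_
      rintro _ rfl
      exact (TwoSidedIdeal.mem_ker _).2 (cycMk_polyElem τ B z f)
    exact TwoSidedIdeal.ringCon_le_iff.1 h

lemma etaBar_mk (x : affPlus τ B z n) :
    etaBar τ B z n f (cycPlusMk τ B z n f x) = eta τ B z n f x := rfl

/-- The universal property of `H_n^aff(A, z)` extends the projection
`H_{n,+}^aff(A, z) → H_{n,+}^f(A, z)` to `H_n^aff(A, z)`. -/
lemma exists_extension (hf : ∀ m, f.coeff m ∈ 𝒜 0) (hunit : IsUnit (f.coeff 0)) :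
    ∃ φ : Aff τ B z n →ₐ[k] CycPlus τ B z n f,
      ∀ x : affPlus τ B z n, φ x = cycPlusMk τ B z n f x := by
  choose y _ hy1 hy2 using exists_inverse_X τ B z (n := n) hf hunit
  let π := cycPlusMk τ B z n f
  let x : Fin n → (CycPlus τ B z n f)ˣ := fun i =>
    ⟨π (affPlus.X τ B z i), π (y i), by rw [← map_mul]; exact hy1 i, by
      rw [← map_mul]; exact hy2 i⟩
  have hx : Pairwise fun i j => Commute (x i) (x j) := fun i j _ => Units.ext <|
    Commute.map (show Commute (affPlus.X τ B z i) (affPlus.X τ B z j) from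
      Subtype.ext (Aff.X_commute τ B z i j)) π
  let g : Wreath τ B z n →ₐ[k] CycPlus τ B z n f := π.comp (affPlus.ofWreath τ B z n)
  -- The relations required by the presentation contain no inverse of any `X_i`, so each is an
  -- identity in the subalgebra, inherited from `H_n^aff`, and is then projected to the quotient.
  let φ := Aff.lift τ B z g x hx
    (fun i j h h' => by
      change π _ * π _ = π _ * π _
      rw [← map_mul, ← map_mul]
      exact congrArg π (Subtype.ext (Aff.T_mul_X τ B z h h')))
    (fun i => by
      change π _ * π _ * π _ = π _
      rw [← map_mul, ← map_mul]
      exact congrArg π (Subtype.ext (Aff.T_mul_X_mul_T τ B z i)))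
    (fun i a => by
      change π _ * π _ = π _ * π _
      rw [← map_mul, ← map_mul]
      exact congrArg π (Subtype.ext (Aff.X_commute_of τ B z i a)))
  have hφ : φ.comp (affPlus τ B z n).val = π :=
    affPlus.algHom_ext (fun w => Aff.lift_ofWreath ..)
      (fun i => (Aff.lift_X ..).trans (by rw [zpow_one]))
  exact ⟨φ, fun w => DFunLike.congr_fun hφ w⟩

/-- Both sides are algebra homomorphisms on `H_n^aff`, determined by `H_n(A, z)` and the `X_i`.
These lie in the subalgebra, where `φ` is the projection. -/
lemma etaBar_extension {φ : Aff τ B z n →ₐ[k] CycPlus τ B z n f}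
    (hφ : ∀ x : affPlus τ B z n, φ x = cycPlusMk τ B z n f x) (x : Aff τ B z n) :
    etaBar τ B z n f (φ x) = cycMk τ B z n f x := by
  refine DFunLike.congr_fun (Aff.algHom_ext (φ := (etaBar τ B z n f).comp φ)
    (ψ := cycMk τ B z n f) (fun w => ?_) fun i => ?_) x
  · exact congrArg (etaBar τ B z n f) (hφ (affPlus.ofWreath τ B z n w))
  · exact congrArg (etaBar τ B z n f) (hφ (affPlus.X τ B z i))

/-- The generator `f` lies in the subalgebra, where `φ` is the projection, so the kernel of `φ`
contains `f` and hence the ideal it generates in the larger algebra. -/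
lemma extension_eq_zero {φ : Aff τ B z n →ₐ[k] CycPlus τ B z n f}
    (hφ : ∀ x : affPlus τ B z n, φ x = cycPlusMk τ B z n f x) {x : Aff τ B z n}
    (hx : x ∈ cycIdeal τ B z n f) : φ x = 0 := by
  have h : cycIdeal τ B z n f ≤ TwoSidedIdeal.ker φ := by
    refine TwoSidedIdeal.span_le.2 ?_
    rintro _ rfl
    exact (TwoSidedIdeal.mem_ker _).2 ((hφ _).trans (cycPlusMk_polyElem τ B z f))
  exact (TwoSidedIdeal.mem_ker _).1 (h hx)

lemma etaBar_bijective (hf : ∀ m, f.coeff m ∈ 𝒜 0) (hunit : IsUnit (f.coeff 0)) :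
    Function.Bijective (etaBar τ B z n f) := by
  obtain ⟨φ, hφ⟩ := exists_extension τ B z (n := n) hf hunit
  refine ⟨(injective_iff_map_eq_zero _).2 fun x hx => ?_, fun x => ?_⟩
  · obtain ⟨x, rfl⟩ := RingCon.mkₐ_surjective (α := k) _ x
    -- A class killed by the induced map is represented by an element of `⟨f⟩` in the subalgebra;
    -- its class is its value under `φ`, which is zero.
    exact (hφ x).symm.trans (extension_eq_zero τ B z hφ ((cycMk_eq_zero τ B z f).1 hx))
  · obtain ⟨x, rfl⟩ := RingCon.mkₐ_surjective (α := k) _ x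
    exact ⟨φ x, etaBar_extension τ B z hφ x⟩

lemma cycIdeal_inter (hf : ∀ m, f.coeff m ∈ 𝒜 0) (hunit : IsUnit (f.coeff 0)) :
    {x : Aff τ B z n | x ∈ cycIdeal τ B z n f} ∩ {x | x ∈ affPlus τ B z n} =
      Subtype.val '' {x : affPlus τ B z n | x ∈ cycIdealPlus τ B z n f} := by
  obtain ⟨φ, hφ⟩ := exists_extension τ B z (n := n) hf hunit
  ext x
  constructor
  · rintro ⟨hx, hx'⟩
    exact ⟨⟨x, hx'⟩, (cycPlusMk_eq_zero τ B z f).1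
      ((hφ ⟨x, hx'⟩).symm.trans (extension_eq_zero τ B z hφ hx)), rfl⟩
  · rintro ⟨x, hx, rfl⟩
    refine ⟨(cycMk_eq_zero τ B z f).1 ?_, x.2⟩
    -- The easy inclusion is the well-definedness of the induced map.
    have h := congrArg (etaBar τ B z n f) ((cycPlusMk_eq_zero τ B z f).2 hx)
    rwa [map_zero] at h

/-- Modulo `f`, homogeneous elements can be represented in `H_{n,+}^aff(A, z)`. -/
lemma exists_homogeneous_lift (hf : ∀ m, f.coeff m ∈ 𝒜 0) (hunit : IsUnit (f.coeff 0))
    {p : ZMod 2} {x : Aff τ B z n} (hx : Aff.IsHomogeneous τ B z n p x) :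
    ∃ y : affPlus τ B z n, (y : Aff τ B z n) ∈ Aff.part τ B z n p ∧
      eta τ B z n f y = cycMk τ B z n f x := by
  induction hx with
  | scalar c => exact ⟨algebraMap k _ c, Aff.IsHomogeneous.scalar c, rfl⟩
  | T i => exact ⟨affPlus.ofWreath τ B z n (Wreath.T τ B z i), Aff.IsHomogeneous.T i, rfl⟩
  | single i p a ha =>
    exact ⟨affPlus.ofWreath τ B z n (Wreath.of τ B z n (SuperPower.single 𝒜 i a)),
      Aff.IsHomogeneous.single i p a ha, rfl⟩
  | zero p => exact ⟨0, Aff.IsHomogeneous.zero p, by rw [map_zero, map_zero]⟩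
  | add _ _ ihx ihy =>
    obtain ⟨x', hx', hx⟩ := ihx
    obtain ⟨y', hy', hy⟩ := ihy
    exact ⟨x' + y', Aff.IsHomogeneous.add hx' hy', by rw [map_add, map_add, hx, hy]⟩
  | mul _ _ ihx ihy =>
    obtain ⟨x', hx', hx⟩ := ihx
    obtain ⟨y', hy', hy⟩ := ihy
    exact ⟨x' * y', Aff.IsHomogeneous.mul hx' hy', by rw [map_mul, map_mul, hx, hy]⟩
  | X i m =>
    have hX : ((affPlus.X τ B z i : affPlus τ B z n) : Aff τ B z n) ∈ Aff.part τ B z n 0 :=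
      Aff.IsHomogeneous.X i 1
    obtain ⟨m, rfl | rfl⟩ := m.eq_nat_or_neg
    · refine ⟨affPlus.X τ B z i ^ m, Aff.pow_mem_part_zero hX m, ?_⟩
      rw [← Aff.X_pow, map_pow, map_pow]
      rfl
    -- Negative powers are the only generators outside the subalgebra. Modulo `f`, `X_i^{-m}` is
    -- represented by `y ^ m`, with `y` the even inverse of `X_i`: the image of `y ^ m` is a left
    -- inverse of that of `X_i^m`, and the image of `X_i^{-m}` a right inverse.
    · obtain ⟨y, hy, -, hy2⟩ := exists_inverse_X τ B z hf hunit i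
      refine ⟨y ^ m, Aff.pow_mem_part_zero hy m, ?_⟩
      have h1 : eta τ B z n f y * cycMk τ B z n f (Aff.X τ B z i 1) = 1 :=
        (map_mul (eta τ B z n f) y (affPlus.X τ B z i)).symm.trans
          ((congrArg (etaBar τ B z n f) hy2).trans (map_one _))
      have h2 : cycMk τ B z n f (Aff.X τ B z i 1) * cycMk τ B z n f (Aff.X τ B z i (-1)) = 1 := by
        rw [← map_mul, Aff.X_mul_X, add_neg_cancel, Aff.X_zero, map_one]
      have h3 : Aff.X τ B z i 1 ^ m * Aff.X τ B z i (-m) = 1 := by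
        rw [Aff.X_pow, Aff.X_mul_X, add_neg_cancel, Aff.X_zero]
      have h4 : eta τ B z n f y ^ m * cycMk τ B z n f (Aff.X τ B z i 1) ^ m = 1 := by
        have hc : Commute (eta τ B z n f y) (cycMk τ B z n f (Aff.X τ B z i 1)) := by
          rw [Commute, SemiconjBy, h1, left_inv_eq_right_inv h1 h2, ← map_mul, Aff.X_mul_X,
            add_neg_cancel, Aff.X_zero, map_one]
        rw [← hc.mul_pow, h1, one_pow]
      rw [map_pow]
      refine left_inv_eq_right_inv h4 ?_
      rw [← map_pow, ← map_mul, h3, map_one]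

/-- A bijective homomorphism respecting parity need only have homogeneous elements hit by
homogeneous ones; this is what `exists_homogeneous_lift` supplies. The other inclusion is immediate,
since `η` keeps the representative. -/
lemma map_cycPlusPart (hf : ∀ m, f.coeff m ∈ 𝒜 0) (hunit : IsUnit (f.coeff 0)) (p : ZMod 2) :
    (cycPlusPart τ B z n f p).map (etaBar τ B z n f).toLinearMap = cycPart τ B z n f p := by
  refine le_antisymm ?_ ?_
  · rintro _ ⟨_, ⟨x, hx, rfl⟩, rfl⟩
    exact ⟨x, hx, rfl⟩
  · rintro _ ⟨x, hx, rfl⟩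
    obtain ⟨y, hy, h⟩ := exists_homogeneous_lift τ B z hf hunit hx
    exact ⟨_, ⟨y, hy, rfl⟩, h⟩

end Cyclotomic

end QuantumWreath

end

theorem mainTheorem8 {k : Type*} {A : Type*} [CommRing k] [Ring A] [Algebra k A]
    (hk : ringChar k ≠ 2)
    (𝒜 : ZMod 2 → Submodule k A) [GradedAlgebra 𝒜] (τ : SuperTrace 𝒜)
    {ι : Type*} [Fintype ι] (B : Module.Basis ι k A)
    (z : k) (n : ℕ) [NeZero n]
    (f : Polynomial A) (hmonic : f.Monic) (hcentral : ∀ m, f.coeff m ∈ evenCenter 𝒜)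
    (hunit : IsUnit (f.coeff 0)) :
    (∃ e : CycPlus τ B z n f ≃ₐ[k] Cyc τ B z n f,
      (∀ x : affPlus τ B z n, e (cycPlusMk τ B z n f x) = eta τ B z n f x) ∧
      ∀ p : ZMod 2, (cycPlusPart τ B z n f p).map e.toLinearMap = cycPart τ B z n f p) ∧
    {x : Aff τ B z n | x ∈ cycIdeal τ B z n f} ∩ {x | x ∈ affPlus τ B z n} =
      Subtype.val '' {x : affPlus τ B z n | x ∈ cycIdealPlus τ B z n f} := by
  have hf : ∀ m, f.coeff m ∈ 𝒜 0 := fun m => (hcentral m).1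
  exact ⟨⟨AlgEquiv.ofBijective (etaBar τ B z n f) (etaBar_bijective τ B z hf hunit),
    etaBar_mk τ B z, map_cycPlusPart τ B z hf hunit⟩, cycIdeal_inter τ B z hf hunit⟩
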